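/- Let $p$ be a prime and let $\mathcal{P}$ be a finite classical polar space over a finite field $\mathbb{F}_q$ of characteristic $p$; that is, $\mathcal{P}$ consists of the totally isotropic (respectively totally singular) subspaces of a finite-dimensional vector space $V$ over $\mathbb{F}_q$ equipped with a non-degenerate alternating form, a non-degenerate Hermitian form (with respect to a non-trivial involutory automorphism of $\mathbb{F}_q$), or a non-singular quadratic form (one for which no nonzero singular vector lies in the radical of the associated bilinear form). Let $r$ be the rank of $\mathcal{P}$, i.e. the maximal vector space dimension of a totally isotropic (respectively totally singular) subspace; the subspaces of this dimension are the generators of $\mathcal{P}$. An $m$-ovoid of $\mathcal{P}$ is a set of points of $\mathcal{P}$ (one-dimensional totally isotropic, respectively singular, subspaces of $V$) that meets every generator in exactly $m$ points. Let $m \geq 2$ be an integer. If $$r \;\geq\; \bigl(m + \log_p\bigl((2m)^2\bigr)\bigr)(p-1) + 1,$$ then $\mathcal{P}$ has no $m$-ovoid. -/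

import Mathlib

open scoped LinearAlgebra.Projectivization

/-- A classical polar space with underlying vector space `V` over the field `K`, given by its
defining form: a non-degenerate alternating form, a non-degenerate Hermitian form with respect to
an involutory automorphism `σ ≠ id` of `K`, or a non-singular quadratic form. A quadratic form is
non-singular when no nonzero singular vector lies in the radical of its polar form; the polar form
itself may be degenerate (parabolic quadrics in characteristic two). -/
inductive ClassicalPolarSpace (K V : Type*) [Field K] [AddCommGroup V] [Module K V]
  | symplectic (B : V →ₗ[K] V →ₗ[K] K) (alt : B.IsAlt) (nondeg : B.Nondegenerate)
  | hermitian (σ : K →+* K) (invol : Function.Involutive σ) (ne_id : σ ≠ RingHom.id K)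
      (B : V →ₛₗ[σ] V →ₗ[K] K) (symm : ∀ x y, σ (B x y) = B y x) (nondeg : B.Nondegenerate)
  | orthogonal (Q : QuadraticForm K V)
      (nonsing : ∀ x, Q x = 0 → (∀ y, QuadraticMap.polar Q x y = 0) → x = 0)

namespace ClassicalPolarSpace

variable {K V : Type*} [Field K] [AddCommGroup V] [Module K V]

/-- The elements of the polar space: the totally isotropic subspaces for the symplectic and
Hermitian forms, the totally singular subspaces for the quadratic forms. -/
def IsElement : ClassicalPolarSpace K V → Submodule K V → Prop
  | symplectic B _ _, W => ∀ x ∈ W, ∀ y ∈ W, B x y = 0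
  | hermitian _ _ _ B _ _, W => ∀ x ∈ W, ∀ y ∈ W, B x y = 0
  | orthogonal Q _, W => ∀ x ∈ W, Q x = 0

/-- The rank: the Witt index of the form, that is, the largest vector space dimension of an
element. -/
noncomputable def rank (P : ClassicalPolarSpace K V) : ℕ :=
  sSup {d : ℕ | ∃ W : Submodule K V, P.IsElement W ∧ Module.finrank K W = d}

/-- The generators: the elements of maximal dimension. -/
def IsGenerator (P : ClassicalPolarSpace K V) (W : Submodule K V) : Prop :=
  P.IsElement W ∧ Module.finrank K W = P.rank

/-- The points of the polar space. -/
def points (P : ClassicalPolarSpace K V) : Set (ℙ K V) :=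
  {X | P.IsElement X.submodule}

/-- An `m`-ovoid: a set of points of the polar space that meets every generator in exactly `m`
points. -/
def IsMOvoid (P : ClassicalPolarSpace K V) (m : ℕ) (O : Set (ℙ K V)) : Prop :=
  O ⊆ P.points ∧ ∀ W : Submodule K V, P.IsGenerator W → {X ∈ O | X.submodule ≤ W}.ncard = m

end ClassicalPolarSpace

/-! Let q = p^h and let O be an m-ovoid. Choose an element T of dimension d < m with fewer than m
points of O, such that joining T to any further point of O collinear with it already gives at least
m points (`exists_saturated`). A generator G through T contains such a further point ⟨x⟩. Put n = r
- d - 1. Each of the q^n functionals on G that vanish on T and equal 1 at x has a kernel with fewer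
than m points of O, so another generator through that kernel contains a point of O outside G
(`exists_point`). Two of these points are never collinear, since by saturation a generator would
then hold more than m points (`form_ne_zero`).

The matrix of form values between these q^n points is zero exactly on the diagonal, yet factors
through 2(n + 1) indices (`exists_matrix`). Its entrywise power with exponent q - 1 is J - I, and
Frobenius additivity bounds the rank of that power, so q^n ≤ (2n + 2)^((p - 1)h) + 1. For large r
this is false. -/

/-! ### Rank bound over a finite field -/

/-- A matrix over a finite field whose zero entries are exactly the diagonal ones and which factors
through an index type `κ` cannot be too large: the entrywise power with exponent `q - 1` is the
all-one matrix minus the identity. -/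
theorem card_le_of_mul_apply_eq_zero_iff {K ι κ : Type*} [Field K] [Fintype K] [Fintype ι]
    [Fintype κ] {p h : ℕ} [CharP K p] [Fact p.Prime]
    (hq : Fintype.card K = p ^ h) (C : Matrix ι κ K) (Z : Matrix κ ι K)
    (hM : ∀ i j, (C * Z) i j = 0 ↔ i = j) :
    Fintype.card ι ≤ (Fintype.card κ ^ (p - 1)) ^ h + 1 := by
  classical
  -- q - 1 = (p - 1)(1 + p + ... + p^(h-1)), so only (p - 1)h Frobenius powers are multiplied.
  have hexp : ∀ x : K, x ^ (Fintype.card K - 1) =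
      ∏ k : Fin h × Fin (p - 1), x ^ (p ^ (k.1 : ℕ)) := by
    intro x
    rw [Finset.prod_pow_eq_pow_sum, hq, Fintype.sum_prod_type]
    simp only [Finset.sum_const, Finset.card_univ, Fintype.card_fin, smul_eq_mul]
    rw [← Finset.mul_sum, Fin.sum_univ_eq_sum_range (fun k => p ^ k),
      Nat.geomSum_eq (Fact.out : p.Prime).two_le, Nat.mul_div_cancel']
    simpa using Nat.sub_dvd_pow_sub_pow p 1 h
  -- The index `none` contributes the all-one matrix; the maps `f` index the terms of the expanded
  -- product of sums.
  let A : Matrix ι (Option (Fin h × Fin (p - 1) → κ)) K := fun i s =>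
    s.elim 1 fun f => ∏ k, C i (f k) ^ (p ^ (k.1 : ℕ))
  let B : Matrix (Option (Fin h × Fin (p - 1) → κ)) ι K := fun s j =>
    s.elim 1 fun f => -∏ k, Z (f k) j ^ (p ^ (k.1 : ℕ))
  have hAB : A * B = 1 := by
    ext i j
    have hpow : ((C * Z) i j) ^ (Fintype.card K - 1) =
        ∑ f : Fin h × Fin (p - 1) → κ,
          (∏ k, C i (f k) ^ (p ^ (k.1 : ℕ))) * ∏ k, Z (f k) j ^ (p ^ (k.1 : ℕ)) := by
      rw [hexp]
      simp only [Matrix.mul_apply, sum_pow_char_pow, mul_pow, ← Finset.prod_mul_distrib]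
      rw [Finset.prod_univ_sum, Fintype.piFinset_univ]
    have hone : (A * B) i j = 1 - ((C * Z) i j) ^ (Fintype.card K - 1) := by
      rw [hpow, Matrix.mul_apply, Fintype.sum_option]
      simp [A, B, sub_eq_add_neg]
    rw [hone, Matrix.one_apply]
    split_ifs with hij
    · rw [(hM i j).2 hij, zero_pow (Nat.sub_ne_zero_of_lt Fintype.one_lt_card), sub_zero]
    · rw [FiniteField.pow_card_sub_one_eq_one _ fun h0 => hij ((hM i j).1 h0), sub_self]
  calc Fintype.card ι = (A * B).rank := by rw [hAB, Matrix.rank_one]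
    _ ≤ A.rank := Matrix.rank_mul_le_left A B
    _ ≤ Fintype.card (Option (Fin h × Fin (p - 1) → κ)) := Matrix.rank_le_card_width A
    _ = _ := by simp [← pow_mul, mul_comm]

/-! ### Numerical estimate -/

/-- The numerical estimate behind the rank bound. -/
theorem two_mul_pow_mul_le_pow_rank {p m r : ℕ} (hp : 2 ≤ p) (hm : 2 ≤ m)
    (hr : ((m : ℝ) + Real.logb (p : ℝ) ((2 * (m : ℝ)) ^ 2)) * ((p : ℝ) - 1) + 1 ≤ (r : ℝ)) :
    2 * p ^ (m - 1) * (2 * r) ^ (p - 1) ≤ p ^ (r - 1) := by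
  have hp' : (2 : ℝ) ≤ p := by exact_mod_cast hp
  have hm' : (2 : ℝ) ≤ m := by exact_mod_cast hm
  have hp0 : (0 : ℝ) < p := by linarith
  have hp1 : (1 : ℝ) < p := by linarith
  set L := Real.logb (p : ℝ) ((2 * (m : ℝ)) ^ 2) with hL
  have hpL : (p : ℝ) ^ L = (2 * (m : ℝ)) ^ 2 :=
    Real.rpow_logb hp0 hp1.ne' (by positivity)
  have hL0 : 0 ≤ L := Real.logb_nonneg hp1 (by nlinarith)
  have hq0 : (0 : ℝ) < (p : ℝ) - 1 := by linarith
  -- δ is the slack in the hypothesis, in units of p - 1.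
  obtain ⟨δ, hδ⟩ : ∃ δ : ℝ, (r : ℝ) = (m + L + δ) * ((p : ℝ) - 1) + 1 :=
    ⟨((r : ℝ) - 1) / ((p : ℝ) - 1) - m - L, by field_simp; ring⟩
  have hδ0 : 0 ≤ δ := by
    by_contra! hneg
    nlinarith
  have hr1 : 1 ≤ r := by
    have : (1 : ℝ) ≤ r := by rw [hδ]; nlinarith [mul_nonneg (by linarith : 0 ≤ m + L + δ) hq0.le]
    exact_mod_cast this
  -- The right-hand side as a power with exponent `p - 1`.
  have hpow : (p : ℝ) ^ (r - 1) =
      ((p : ℝ) ^ m * (2 * (m : ℝ)) ^ 2 * (p : ℝ) ^ δ) ^ (p - 1) := by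
    rw [← hpL, ← Real.rpow_natCast (p : ℝ) m, ← Real.rpow_add hp0, ← Real.rpow_add hp0,
      ← Real.rpow_natCast, ← Real.rpow_natCast, ← Real.rpow_mul hp0.le]
    congr 1
    rw [Nat.cast_sub hr1, Nat.cast_sub (by omega : 1 ≤ p), hδ]
    push_cast
    ring
  have hL2 : L ≤ 2 * m := by
    have h2m : (2 * m : ℕ) ≤ 2 ^ m := by
      obtain ⟨k, rfl⟩ : ∃ k, m = k + 1 := ⟨m - 1, by omega⟩
      rw [pow_succ, mul_comm]
      exact Nat.mul_le_mul_right 2 Nat.lt_two_pow_self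
    have h2m' : (2 * m : ℝ) ≤ 2 ^ m := by exact_mod_cast h2m
    rw [hL, Real.logb_le_iff_le_rpow hp1 (by positivity), mul_comm (2 : ℝ) (m : ℝ),
      Real.rpow_mul hp0.le, Real.rpow_natCast, Real.rpow_two, mul_comm (m : ℝ) 2]
    gcongr
    exact h2m'.trans (by gcongr)
  have hlog2 := Real.log_two_gt_d9
  have hbern : 1 + δ / 2 ≤ (p : ℝ) ^ δ := by
    calc 1 + δ / 2 ≤ δ * Real.log 2 + 1 := by nlinarith
      _ ≤ Real.exp (δ * Real.log 2) := Real.add_one_le_exp _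
      _ = (2 : ℝ) ^ δ := by rw [Real.rpow_def_of_pos (by norm_num), mul_comm]
      _ ≤ (p : ℝ) ^ δ := Real.rpow_le_rpow (by norm_num) hp' hδ0
  have hgoal : (2 : ℝ) * p ^ (m - 1) * (2 * r) ^ (p - 1) ≤ p ^ (r - 1) := by
    rw [hpow]
    rcases hp.eq_or_lt with rfl | hp3
    · have h2 : (2 : ℝ) ^ m = 2 * 2 ^ (m - 1) := by rw [← pow_succ']; congr 1; omega
      push_cast at hbern hδ ⊢
      rw [h2, mul_assoc (2 * 2 ^ (m - 1) : ℝ)]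
      simp only [pow_one]
      refine mul_le_mul_of_nonneg_left ?_ (by positivity)
      nlinarith [mul_le_mul_of_nonneg_left hbern (by positivity : (0 : ℝ) ≤ (2 * (m : ℝ)) ^ 2),
        mul_nonneg hδ0 (by nlinarith : (0 : ℝ) ≤ (m : ℝ) ^ 2 - 1)]
    -- Split p^m = D * D: one factor absorbs 2p^(m-1) ≤ D^2 ≤ D^(p-1), which needs p ≥ 3; the other
    -- absorbs the p in r ≤ p(3m + δ).
    · set D : ℝ := Real.sqrt ((p : ℝ) ^ m) with hD
      have hDsq : D ^ 2 = (p : ℝ) ^ m := Real.sq_sqrt (by positivity)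
      have hDp : (p : ℝ) ≤ D :=
        Real.le_sqrt_of_sq_le (pow_le_pow_right₀ hp1.le hm)
      have h1 : (2 : ℝ) * p ^ (m - 1) ≤ D ^ (p - 1) := by
        calc (2 : ℝ) * p ^ (m - 1) ≤ p * p ^ (m - 1) := by gcongr
          _ = D ^ 2 := by rw [hDsq, ← pow_succ']; congr 1; omega
          _ ≤ D ^ (p - 1) := pow_le_pow_right₀ (by linarith) (by omega)
      have hr' : (r : ℝ) ≤ p * (3 * m + δ) := by nlinarith
      have h3 : 3 * m + δ ≤ 2 * (m : ℝ) ^ 2 * p ^ δ := by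
        nlinarith [mul_le_mul_of_nonneg_left hbern (by positivity : (0 : ℝ) ≤ 2 * (m : ℝ) ^ 2),
          mul_nonneg hδ0 (by nlinarith : (0 : ℝ) ≤ (m : ℝ) ^ 2 - 1)]
      calc (2 : ℝ) * p ^ (m - 1) * (2 * r) ^ (p - 1) ≤ D ^ (p - 1) * (2 * r) ^ (p - 1) := by gcongr
        _ = (D * (2 * r)) ^ (p - 1) := (mul_pow _ _ _).symm
        _ ≤ (D * (2 * (D * (2 * (m : ℝ) ^ 2 * p ^ δ)))) ^ (p - 1) := by
          gcongr
          exact hr'.trans (by gcongr)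
        _ = _ := by rw [← hDsq]; congr 1; ring
  exact_mod_cast hgoal

/-! ### Polar forms and totally singular subspaces -/

/-- The data common to the three types of classical polar spaces: a reflexive sesquilinear form
together with the set of its singular vectors. -/
structure PolarForm (K V : Type*) [Field K] [AddCommGroup V] [Module K V] where
  /-- The field automorphism attached to the form. -/
  σ : K →+* K
  involutive : Function.Involutive σ
  /-- The sesquilinear form. -/
  form : V →ₛₗ[σ] V →ₗ[K] K
  /-- The singular vectors. -/
  IsSingular : V → Prop
  form_comm : ∀ {x y}, form x y = 0 → form y x = 0
  form_self : ∀ {x}, IsSingular x → form x x = 0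
  isSingular_add : ∀ {x y}, IsSingular x → IsSingular y → form x y = 0 → IsSingular (x + y)
  isSingular_smul : ∀ (c : K) {x}, IsSingular x → IsSingular (c • x)
  -- Nondegeneracy is asked only at singular vectors, which admits quadratic forms with degenerate
  -- polar form.
  eq_zero : ∀ {x}, IsSingular x → (∀ y, form y x = 0) → x = 0
  exists_isSingular_add_smul : ∀ {e v}, IsSingular e → form v e ≠ 0 → ∃ c : K,
    IsSingular (v + c • e)

namespace PolarForm

variable {K V : Type*} [Field K] [AddCommGroup V] [Module K V] (F : PolarForm K V)

/-- Totally singular subspaces. -/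
def IsTotallySingular (W : Submodule K V) : Prop :=
  (∀ x ∈ W, F.IsSingular x) ∧ ∀ x ∈ W, ∀ y ∈ W, F.form x y = 0

variable {F}

theorem IsTotallySingular.mono {W W' : Submodule K V} (hW : F.IsTotallySingular W)
    (h : W' ≤ W) : F.IsTotallySingular W' :=
  ⟨fun x hx => hW.1 x (h hx), fun x hx y hy => hW.2 x (h hx) y (h hy)⟩

theorem IsTotallySingular.sup {W W' : Submodule K V} (hW : F.IsTotallySingular W)
    (hW' : F.IsTotallySingular W') (h : ∀ x ∈ W, ∀ y ∈ W', F.form x y = 0) :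
    F.IsTotallySingular (W ⊔ W') := by
  constructor
  · intro z hz
    obtain ⟨x, hx, y, hy, rfl⟩ := Submodule.mem_sup.1 hz
    exact F.isSingular_add (hW.1 x hx) (hW'.1 y hy) (h x hx y hy)
  · intro z hz z' hz'
    obtain ⟨x, hx, y, hy, rfl⟩ := Submodule.mem_sup.1 hz
    obtain ⟨x', hx', y', hy', rfl⟩ := Submodule.mem_sup.1 hz'
    simp only [map_add, LinearMap.add_apply, hW.2 x hx x' hx', hW'.2 y hy y' hy', h x hx y' hy',
      F.form_comm (h x' hx' y hy), add_zero]

theorem isTotallySingular_span_singleton {x : V} (hx : F.IsSingular x) :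
    F.IsTotallySingular (Submodule.span K {x}) := by
  constructor
  · intro z hz
    obtain ⟨c, rfl⟩ := Submodule.mem_span_singleton.1 hz
    exact F.isSingular_smul c hx
  · intro z hz z' hz'
    obtain ⟨c, rfl⟩ := Submodule.mem_span_singleton.1 hz
    obtain ⟨c', rfl⟩ := Submodule.mem_span_singleton.1 hz'
    simp [F.form_self hx]

theorem IsTotallySingular.sup_span_singleton {W : Submodule K V} (hW : F.IsTotallySingular W)
    {y : V} (hy : F.IsSingular y) (h : ∀ x ∈ W, F.form x y = 0) :
    F.IsTotallySingular (W ⊔ Submodule.span K {y}) := by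
  refine hW.sup (isTotallySingular_span_singleton hy) fun x hx z hz => ?_
  obtain ⟨c, rfl⟩ := Submodule.mem_span_singleton.1 hz
  simp [h x hx]

/-- Every totally singular subspace `W` is contained in one whose dimension is at least that of a
given totally singular subspace `G`. -/
theorem IsTotallySingular.exists_le_finrank [FiniteDimensional K V] {W G : Submodule K V}
    (hW : F.IsTotallySingular W) (hG : F.IsTotallySingular G) :
    ∃ W', W ≤ W' ∧ F.IsTotallySingular W' ∧ Module.finrank K G ≤ Module.finrank K W' := by
  -- Add to W the part D of G orthogonal to C. It is orthogonal to W ⊓ G for free, and its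
  -- codimension in G is at most dim C = dim W - dim (W ⊓ G).
  obtain ⟨C, hC⟩ := Submodule.exists_isCompl ((W ⊓ G).submoduleOf W)
  let b := Module.finBasis K C
  let φ : G →ₗ[K] (Fin (Module.finrank K C) → K) :=
    LinearMap.pi fun i => (F.form (b i : W)).comp G.subtype
  let D : Submodule K V := (LinearMap.ker φ).map G.subtype
  have hDG : D ≤ G := Submodule.map_subtype_le _ _
  have hC0 : ∀ c : C, ∀ y ∈ D, F.form (c : W) y = 0 := by
    rintro c _ ⟨y, hy, rfl⟩
    have hy' : ∀ i, F.form (b i : W) y = 0 := fun i => congrFun (LinearMap.mem_ker.1 hy) i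
    have hc : ((c : W) : V) = ∑ i, b.repr c i • ((b i : W) : V) := by
      simpa only [map_sum, map_smul, LinearMap.comp_apply, Submodule.subtype_apply] using
        congrArg (W.subtype ∘ₗ C.subtype) (b.sum_repr c).symm
    simp [hc, hy']
  have hWD : ∀ x ∈ W, ∀ y ∈ D, F.form x y = 0 := by
    intro x hx y hy
    have hx' : (⟨x, hx⟩ : W) ∈ (W ⊓ G).submoduleOf W ⊔ C := by rw [hC.sup_eq_top]; trivial
    obtain ⟨u, hu, c, hc, huc⟩ := Submodule.mem_sup.1 hx'
    have : x = (u : V) + (c : V) := by rw [← Submodule.coe_add, huc]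
    rw [this, map_add, LinearMap.add_apply, hC0 ⟨c, hc⟩ y hy,
      hG.2 u (Submodule.mem_inf.1 hu).2 y (hDG hy), add_zero]
  refine ⟨W ⊔ D, le_sup_left, hW.sup (hG.mono hDG) hWD, ?_⟩
  have h1 := Submodule.finrank_sup_add_finrank_inf_eq W D
  have h2 : Module.finrank K (W ⊓ D : Submodule K V) ≤ Module.finrank K (W ⊓ G : Submodule K V) :=
    Submodule.finrank_mono (inf_le_inf_left W hDG)
  have h3 := Submodule.finrank_add_eq_of_isCompl hC
  have h4 : Module.finrank K ((W ⊓ G).submoduleOf W) = Module.finrank K (W ⊓ G : Submodule K V) :=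
    (Submodule.submoduleOfEquivOfLe inf_le_left).finrank_eq
  have h5 := LinearMap.finrank_range_add_finrank_ker φ
  have h6 : Module.finrank K (LinearMap.range φ) ≤ Module.finrank K C := by
    simpa using Submodule.finrank_le (LinearMap.range φ)
  have h7 : Module.finrank K D = Module.finrank K (LinearMap.ker φ) :=
    Submodule.finrank_map_subtype_eq _ _
  omega

/-- Every functional on a totally singular subspace is given by the form. -/
theorem IsTotallySingular.exists_form_eq [FiniteDimensional K V] {G : Submodule K V}
    (hG : F.IsTotallySingular G) (a : Module.Dual K G) : ∃ v : V, ∀ g : G, F.form v g = a g := by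
  let N : Submodule K (Module.Dual K G) :=
    { carrier := {a | ∃ v : V, ∀ g : G, F.form v g = a g}
      zero_mem' := ⟨0, by simp⟩
      add_mem' := by
        rintro a b ⟨v, hv⟩ ⟨w, hw⟩
        exact ⟨v + w, fun g => by simp [hv, hw]⟩
      smul_mem' := by
        rintro c a ⟨v, hv⟩
        exact ⟨F.σ c • v, fun g => by simp [hv, F.involutive c]⟩ }
  suffices h : N = ⊤ by
    have : a ∈ N := h ▸ Submodule.mem_top
    exact this
  -- A common zero of all functionals in N is a singular vector in the radical, hence 0.
  rw [← Subspace.dualCoannihilator_dualAnnihilator_eq (W := N)]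
  have : N.dualCoannihilator = ⊥ := by
    rw [eq_bot_iff]
    intro g hg
    rw [Submodule.mem_dualCoannihilator] at hg
    have := F.eq_zero (hG.1 g g.2) fun y => hg ((F.form y).comp G.subtype) ⟨y, fun _ => rfl⟩
    simpa using this
  rw [this, Submodule.dualAnnihilator_bot]

end PolarForm

/-! ### The three classical types -/

namespace ClassicalPolarSpace

variable {K V : Type*} [Field K] [AddCommGroup V] [Module K V]

/-- If the trace d + σ d vanished identically, d = 1 would force characteristic 2 and then σ = id. A
nonzero trace value can be rescaled, since it is fixed by σ. -/
theorem exists_add_map_eq {σ : K →+* K} (invol : Function.Involutive σ) (ne_id : σ ≠ RingHom.id K)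
    {s : K} (hs : σ s = s) : ∃ c, c + σ c = s := by
  obtain ⟨d, hd⟩ : ∃ d, d + σ d ≠ 0 := by
    by_contra! h
    have h1 := h 1
    rw [map_one] at h1
    refine ne_id (RingHom.ext fun d => ?_)
    have : d + σ d = d * (1 + 1) := by rw [h1, h d, mul_zero]
    simpa [mul_add] using this
  refine ⟨s * d / (d + σ d), ?_⟩
  simp only [map_div₀, map_mul, map_add, invol d, hs]
  rw [add_comm (σ d) d]
  field_simp

/-- The totally singular subspaces of a classical polar space are those of a `PolarForm`. -/
theorem exists_polarForm (P : ClassicalPolarSpace K V) :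
    ∃ F : PolarForm K V, ∀ W, P.IsElement W ↔ F.IsTotallySingular W := by
  cases P with
  | symplectic B alt nondeg =>
    refine ⟨⟨RingHom.id K, fun _ => rfl, B, fun _ => True, fun h => alt.isRefl _ _ h,
      fun _ => alt _, fun _ _ _ => trivial, fun _ _ _ => trivial,
      fun _ h => nondeg.2 _ h, fun _ _ => ⟨0, trivial⟩⟩, fun W => ?_⟩
    simp [IsElement, PolarForm.IsTotallySingular]
  | hermitian σ invol ne_id B symm nondeg =>
    refine ⟨⟨σ, invol, B, fun x => B x x = 0, ?_, id, ?_, ?_, fun _ h => nondeg.2 _ h, ?_⟩,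
      fun W => ?_⟩
    · intro x y h
      rw [← symm x y, h, map_zero]
    · intro x y hx hy h
      have h' : B y x = 0 := by rw [← symm x y, h, map_zero]
      simp [hx, hy, h, h']
    · intro c x hx
      simp [hx]
    · intro e v he hv
      obtain ⟨c, hc⟩ := exists_add_map_eq invol ne_id (s := -B v v) (by rw [map_neg, symm])
      -- With this coefficient the form value of the new vector at itself is B v v + c + σ c.
      refine ⟨c / B v e, ?_⟩
      have hev : B e v ≠ 0 := by
        rw [← symm v e]
        exact (map_ne_zero σ).2 hv
      simp only [map_add, LinearMap.add_apply, LinearMap.map_smulₛₗ, LinearMap.smul_apply, he,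
        RingHom.id_apply, smul_eq_mul, map_div₀, symm]
      linear_combination hc + div_mul_cancel₀ c hv + div_mul_cancel₀ (σ c) hev
    · simp only [IsElement, PolarForm.IsTotallySingular]
      exact ⟨fun h => ⟨fun x hx => h x hx x hx, h⟩, fun h => h.2⟩
  | orthogonal Q nonsing =>
    refine ⟨⟨RingHom.id K, fun _ => rfl, Q.polarBilin, fun x => Q x = 0, ?_, ?_, ?_, ?_, ?_, ?_⟩,
      fun W => ?_⟩
    · intro x y h
      simpa [QuadraticMap.polar_comm] using h
    · intro x hx
      simp [QuadraticMap.polar_self, hx]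
    · intro x y hx hy h
      have : QuadraticMap.polar Q x y = 0 := h
      simpa [QuadraticMap.polar, hx, hy] using this
    · intro c x hx
      simp [QuadraticMap.map_smul, hx]
    · intro x hx h
      refine nonsing x hx fun y => ?_
      rw [QuadraticMap.polar_comm]
      exact h y
    · intro e v he hv
      refine ⟨-Q v / Q.polarBilin v e, ?_⟩
      have hv' : QuadraticMap.polar Q v e ≠ 0 := hv
      simp only [QuadraticMap.polarBilin_apply_apply]
      rw [QuadraticMap.map_add Q, QuadraticMap.polar_smul_right, QuadraticMap.map_smul, he]
      simp only [smul_eq_mul]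
      field_simp
      ring
    · simp only [IsElement, PolarForm.IsTotallySingular]
      refine ⟨fun h => ⟨h, fun x hx y hy => ?_⟩, fun h => h.1⟩
      simp [QuadraticMap.polar, h _ hx, h _ hy, h _ (W.add_mem hx hy)]

end ClassicalPolarSpace

/-- Functionals vanishing on `T`: one with value `1` at `x`, and a basis of those vanishing at `x`. -/
theorem exists_dual_family {K E : Type*} [Field K] [AddCommGroup E] [Module K E]
    [FiniteDimensional K E] {T : Submodule K E} {x : E} (hx : x ∉ T) {n : ℕ}
    (hn : Module.finrank K E = Module.finrank K T + 1 + n) :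
    ∃ a : Option (Fin n) → Module.Dual K E, (∀ k, ∀ t ∈ T, a k t = 0) ∧ a none x = 1 ∧
      (∀ k, a (some k) x = 0) ∧ LinearIndependent K fun k => a (some k) := by
  obtain ⟨f, hfx, hfT⟩ := Submodule.exists_le_ker_of_notMem hx
  have hx0 : x ≠ 0 := fun h => hx (h ▸ T.zero_mem)
  -- The functionals vanishing at x are pulled back from a dual basis of E ⧸ S.
  let S := T ⊔ Submodule.span K {x}
  have hS : Module.finrank K S = Module.finrank K T + 1 := by
    have h := Submodule.finrank_sup_add_finrank_inf_eq T (Submodule.span K {x})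
    have hinf : T ⊓ Submodule.span K {x} = ⊥ :=
      (Submodule.disjoint_span_singleton' hx0).2 hx |>.eq_bot
    rw [hinf, finrank_bot, finrank_span_singleton hx0] at h
    exact h
  have hN : Module.finrank K (E ⧸ S) = n := by
    have := S.finrank_quotient_add_finrank
    omega
  let b := Module.finBasisOfFinrankEq K (E ⧸ S) hN
  have hb : ∀ k, ∀ s ∈ S, (b.coord k ∘ₗ S.mkQ) s = 0 := fun k s hs => by
    simp [(Submodule.Quotient.mk_eq_zero S).2 hs]
  refine ⟨fun k => k.elim ((f x)⁻¹ • f) fun k => b.coord k ∘ₗ S.mkQ, ?_, ?_, ?_, ?_⟩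
  · rintro (_ | k) t ht
    · simp [show f t = 0 from hfT ht]
    · exact hb k t (Submodule.mem_sup_left ht)
  · simp [hfx]
  · exact fun k => hb k x (Submodule.mem_sup_right (Submodule.mem_span_singleton_self x))
  · rw [Fintype.linearIndependent_iff]
    intro c hc j
    obtain ⟨e, he⟩ := S.mkQ_surjective (b j)
    have := LinearMap.congr_fun hc e
    simpa [← Submodule.mkQ_apply, he, Finsupp.single_apply] using this

/-! ### From an m-ovoid to a matrix -/

namespace ClassicalPolarSpace

variable {K V : Type*} [Field K] [AddCommGroup V] [Module K V] {P : ClassicalPolarSpace K V}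
  {F : PolarForm K V} {m : ℕ} {O : Set (ℙ K V)}

section

variable [FiniteDimensional K V]

theorem IsElement.finrank_le_rank {W : Submodule K V} (hW : P.IsElement W) :
    Module.finrank K W ≤ P.rank :=
  le_csSup ⟨Module.finrank K V, by rintro _ ⟨W, -, rfl⟩; exact W.finrank_le⟩ ⟨W, hW, rfl⟩

theorem exists_isGenerator (hF : ∀ W, P.IsElement W ↔ F.IsTotallySingular W) :
    ∃ G, P.IsGenerator G := by
  have hbot : P.IsElement ⊥ := by
    have h0 : F.IsSingular 0 := by
      obtain ⟨W, hW⟩ : ∃ W, P.IsElement W := by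
        cases P <;> exact ⟨⊥, by simp [IsElement]⟩
      exact ((hF W).1 hW).1 0 W.zero_mem
    rw [hF]
    exact ⟨by simpa using h0, by simp⟩
  exact Nat.sSup_mem (s := {d : ℕ | ∃ W : Submodule K V, P.IsElement W ∧ Module.finrank K W = d})
    ⟨_, ⊥, hbot, rfl⟩ ⟨Module.finrank K V, by rintro _ ⟨W, -, rfl⟩; exact W.finrank_le⟩

theorem IsElement.exists_isGenerator_le (hF : ∀ W, P.IsElement W ↔ F.IsTotallySingular W)
    {W : Submodule K V} (hW : P.IsElement W) : ∃ G, P.IsGenerator G ∧ W ≤ G := by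
  obtain ⟨G, hG⟩ := exists_isGenerator hF
  obtain ⟨W', hle, hW', hfin⟩ := ((hF W).1 hW).exists_le_finrank ((hF G).1 hG.1)
  have hE := (hF W').2 hW'
  exact ⟨W', ⟨hE, le_antisymm hE.finrank_le_rank (hG.2 ▸ hfin)⟩, hle⟩

end

variable [Finite K] [FiniteDimensional K V]

theorem finite_projectivization : Finite (ℙ K V) := by
  have : Finite V := Module.finite_of_finite K
  infer_instance

theorem ncard_points_lt {W W' : Submodule K V} (h : W ≤ W') {X : ℙ K V}
    (hX : X ∈ O) (hXW : ¬ X.submodule ≤ W) (hXW' : X.submodule ≤ W') :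
    {X ∈ O | X.submodule ≤ W}.ncard < {X ∈ O | X.submodule ≤ W'}.ncard := by
  have := finite_projectivization (K := K) (V := V)
  refine Set.ncard_lt_ncard ⟨fun X hX => ⟨hX.1, hX.2.trans h⟩, fun hsub => ?_⟩ (Set.toFinite _)
  exact hXW (hsub ⟨hX, hXW'⟩).2

/-- There is an element `T` of small dimension with fewer than `m` points of `O` such that joining
`T` with any further point of `O` collinear with it yields at least `m` points. -/
theorem exists_saturated (hF : ∀ W, P.IsElement W ↔ F.IsTotallySingular W) (hm : 0 < m)
    (O : Set (ℙ K V)) :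
    ∃ T, P.IsElement T ∧ Module.finrank K T < m ∧ {X ∈ O | X.submodule ≤ T}.ncard < m ∧
      ∀ X ∈ O, P.IsElement (T ⊔ X.submodule) → ¬ X.submodule ≤ T →
        m ≤ {Y ∈ O | Y.submodule ≤ T ⊔ X.submodule}.ncard := by
  have : Finite V := Module.finite_of_finite K
  let n : Submodule K V → ℕ := fun W => {X ∈ O | X.submodule ≤ W}.ncard
  -- The condition dim T ≤ n T bounds the dimension and survives adjoining a point of O: the
  -- dimension grows by at most 1, the count by at least 1.
  let S : Set (Submodule K V) := {T | P.IsElement T ∧ Module.finrank K T ≤ n T ∧ n T < m}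
  have hbot : ⊥ ∈ S := by
    obtain ⟨G, hG⟩ := exists_isGenerator hF
    have hn : n ⊥ = 0 := by
      have : {X ∈ O | X.submodule ≤ ⊥} = ∅ := by
        ext X
        simp only [Set.mem_ofPred_eq, le_bot_iff, Set.mem_empty_iff_false, iff_false, not_and]
        intro _ h
        have := X.finrank_submodule
        rw [h, finrank_bot] at this
        omega
      change Set.ncard _ = 0
      rw [this, Set.ncard_empty]
    exact ⟨(hF _).2 (((hF G).1 hG.1).mono bot_le), by simp, hn ▸ hm⟩
  obtain ⟨T, ⟨hT, hTn, hTm⟩, hmax⟩ := Set.exists_max_image S n (Set.toFinite S) ⟨⊥, hbot⟩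
  refine ⟨T, hT, hTn.trans_lt hTm, hTm, fun X hX hE hXT => ?_⟩
  by_contra! hlt
  have hgt : n T < n (T ⊔ X.submodule) := ncard_points_lt le_sup_left hX hXT le_sup_right
  refine absurd (hmax (T ⊔ X.submodule) ⟨hE, ?_, hlt⟩) (not_le.2 hgt)
  have h1 := Submodule.finrank_add_le_finrank_add_finrank T X.submodule
  have h2 := X.finrank_submodule
  omega

/-- Two points of an `m`-ovoid that are collinear with a saturated element `T` and span different
subspaces with it are not collinear. -/
theorem IsMOvoid.form_ne_zero (hF : ∀ W, P.IsElement W ↔ F.IsTotallySingular W)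
    (hO : P.IsMOvoid m O) {T : Submodule K V} (hT : P.IsElement T)
    (hsat : ∀ X ∈ O, P.IsElement (T ⊔ X.submodule) → ¬ X.submodule ≤ T →
        m ≤ {Y ∈ O | Y.submodule ≤ T ⊔ X.submodule}.ncard)
    {X Y : ℙ K V} (hX : X ∈ O) (hY : Y ∈ O) {x y : V} (hx : X.submodule = Submodule.span K {x})
    (hy : Y.submodule = Submodule.span K {y}) (hTx : ∀ t ∈ T, F.form t x = 0)
    (hTy : ∀ t ∈ T, F.form t y = 0) (hxT : x ∉ T) (hyT : y ∉ T ⊔ Submodule.span K {x}) :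
    F.form x y ≠ 0 := by
  intro hxy
  have hsing : ∀ {Z : ℙ K V} {z : V}, Z ∈ O → Z.submodule = Submodule.span K {z} →
      F.IsSingular z := fun {Z z} hZ hz =>
    ((hF _).1 (hO.1 hZ)).1 z (hz ▸ Submodule.mem_span_singleton_self z)
  have hTX := ((hF T).1 hT).sup_span_singleton (hsing hX hx) hTx
  have hTXY := hTX.sup_span_singleton (hsing hY hy) (by
    intro z hz
    obtain ⟨t, ht, w, hw, rfl⟩ := Submodule.mem_sup.1 hz
    obtain ⟨c, rfl⟩ := Submodule.mem_span_singleton.1 hw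
    simp [hTy t ht, hxy])
  have hle := hsat X hX (by rw [hx, hF]; exact hTX) (by
    rw [hx, Submodule.span_singleton_le_iff_mem]
    exact hxT)
  rw [hx] at hle
  obtain ⟨G, hG, hGle⟩ := ((hF _).2 hTXY).exists_isGenerator_le hF
  have hlt := ncard_points_lt (O := O) (le_sup_left.trans hGle) hY
    (by rw [hy, Submodule.span_singleton_le_iff_mem]; exact hyT)
    (by rw [hy]; exact le_sup_right.trans hGle)
  rw [hO.2 G hG] at hlt
  omega

/-- Points of an `m`-ovoid in the generators meeting a given generator in a hyperplane. -/
theorem IsMOvoid.exists_point (hF : ∀ W, P.IsElement W ↔ F.IsTotallySingular W)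
    (hO : P.IsMOvoid m O) {T G : Submodule K V} (hG : P.IsGenerator G)
    (hTm : {X ∈ O | X.submodule ≤ T}.ncard < m) {x : V} (hxG : x ∈ G)
    (hGO : ∀ X ∈ O, X.submodule ≤ G → X.submodule ≤ T ⊔ Submodule.span K {x}) {v : V}
    (hvT : ∀ t ∈ T, F.form v t = 0) (hvx : F.form v x = 1) :
    ∃ g ∈ G, ∃ X ∈ O, X.submodule = Submodule.span K {g + v} := by
  have hGs := (hF G).1 hG.1
  obtain ⟨c, hc⟩ := F.exists_isSingular_add_smul (hGs.1 x hxG) (v := v) (by simp [hvx])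
  -- Moving v along x makes it singular without changing its functional on G.
  set w := v + c • x with hw
  have hwG : ∀ g ∈ G, F.form w g = F.form v g := fun g hg => by simp [hw, hGs.2 x hxG g hg]
  let U : Submodule K V := G ⊓ LinearMap.ker (F.form v)
  have hwU : w ∉ U := fun h => by
    have h1 := hGs.2 w h.1 x hxG
    rw [hwG x hxG, hvx] at h1
    exact one_ne_zero h1
  have hUG : G ≤ U ⊔ Submodule.span K {x} := by
    intro g hg
    refine Submodule.mem_sup.2 ⟨g - F.form v g • x, ⟨G.sub_mem hg (G.smul_mem _ hxG), ?_⟩,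
      F.form v g • x, Submodule.smul_mem _ _ (Submodule.mem_span_singleton_self x), by simp⟩
    simp [hvx]
  have hEl : P.IsElement (U ⊔ Submodule.span K {w}) := by
    rw [hF]
    refine (hGs.mono inf_le_left).sup_span_singleton hc fun u hu => F.form_comm ?_
    rw [hwG u hu.1]
    exact hu.2
  have hw0 : w ≠ 0 := fun h => hwU (h ▸ U.zero_mem)
  have hGen : P.IsGenerator (U ⊔ Submodule.span K {w}) := by
    refine ⟨hEl, le_antisymm hEl.finrank_le_rank ?_⟩
    have h1 := Submodule.finrank_sup_add_finrank_inf_eq U (Submodule.span K {w})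
    rw [((Submodule.disjoint_span_singleton' hw0).2 hwU).eq_bot, finrank_bot,
      finrank_span_singleton hw0] at h1
    have h2 := Submodule.finrank_mono hUG
    have h3 := Submodule.finrank_add_le_finrank_add_finrank U (Submodule.span K {x})
    have h4 := finrank_span_le_card (R := K) ({x} : Set V)
    simp only [Set.toFinset_card, Fintype.card_unique] at h4
    have h5 := hG.2
    omega
  -- Points of O in G lie in T ⊔ ⟨x⟩, and there the functional of v vanishes only on T.
  have hUT : {X ∈ O | X.submodule ≤ U} ⊆ {X ∈ O | X.submodule ≤ T} := by
    rintro X ⟨hX, hXU⟩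
    refine ⟨hX, fun z hz => ?_⟩
    obtain ⟨t, ht, s, hs, rfl⟩ := Submodule.mem_sup.1 (hGO X hX (hXU.trans inf_le_left) hz)
    obtain ⟨e, rfl⟩ := Submodule.mem_span_singleton.1 hs
    have h0 : F.form v (t + e • x) = 0 := (hXU hz).2
    simp only [map_add, hvT t ht, map_smul, hvx, smul_eq_mul, mul_one, zero_add] at h0
    simpa [h0] using ht
  have hfin := finite_projectivization (K := K) (V := V)
  have hlt : {X ∈ O | X.submodule ≤ U}.ncard <
      {X ∈ O | X.submodule ≤ U ⊔ Submodule.span K {w}}.ncard := by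
    rw [hO.2 _ hGen]
    exact (Set.ncard_le_ncard hUT (Set.toFinite _)).trans_lt hTm
  obtain ⟨X, hX, hXU⟩ := Set.exists_mem_notMem_of_ncard_lt_ncard hlt (Set.toFinite _)
  obtain ⟨u, hu, s, hs, hus⟩ := Submodule.mem_sup.1
    (hX.2 (X.submodule_eq ▸ Submodule.mem_span_singleton_self X.rep))
  obtain ⟨e, rfl⟩ := Submodule.mem_span_singleton.1 hs
  have he : e ≠ 0 := by
    rintro rfl
    refine hXU ⟨hX.1, ?_⟩
    rw [X.submodule_eq, Submodule.span_singleton_le_iff_mem, ← hus]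
    simpa using hu
  refine ⟨e⁻¹ • u + c • x, G.add_mem (G.smul_mem _ hu.1) (G.smul_mem _ hxG), X, hX.1, ?_⟩
  have : e⁻¹ • u + c • x + v = e⁻¹ • X.rep := by
    rw [← hus, smul_add, inv_smul_smul₀ he, hw]
    abel
  rw [this, X.submodule_eq, Submodule.span_singleton_smul_eq (isUnit_iff_ne_zero.2 (inv_ne_zero he))]

/-- An `m`-ovoid yields a large matrix of small rank over `K` that vanishes exactly on the
diagonal. -/
theorem IsMOvoid.exists_matrix (hO : P.IsMOvoid m O) (hm : 0 < m) :
    ∃ d n, d < m ∧ P.rank = d + 1 + n ∧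
      ∃ (C : Matrix (Fin n → K) (Option (Fin n) ⊕ Option (Fin n)) K)
        (Z : Matrix (Option (Fin n) ⊕ Option (Fin n)) (Fin n → K) K),
        ∀ i j, (C * Z) i j = 0 ↔ i = j := by
  obtain ⟨F, hF⟩ := P.exists_polarForm
  obtain ⟨T, hT, hTd, hTm, hsat⟩ := exists_saturated hF hm O
  obtain ⟨G, hG, hTG⟩ := hT.exists_isGenerator_le hF
  have hGs := (hF G).1 hG.1
  have hfin := finite_projectivization (K := K) (V := V)
  obtain ⟨X₀, hX₀, hX₀T⟩ := Set.exists_mem_notMem_of_ncard_lt_ncard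
    (hTm.trans_eq (hO.2 G hG).symm) (Set.toFinite _)
  set x := X₀.rep
  have hX₀x : X₀.submodule = Submodule.span K {x} := X₀.submodule_eq
  have hxG : x ∈ G := by
    have := hX₀.2
    rwa [hX₀x, Submodule.span_singleton_le_iff_mem] at this
  have hX₀T' : ¬ X₀.submodule ≤ T := fun h => hX₀T ⟨hX₀.1, h⟩
  have hxT : x ∉ T := by rwa [hX₀x, Submodule.span_singleton_le_iff_mem] at hX₀T'
  have hTxG : T ⊔ Submodule.span K {x} ≤ G := sup_le hTG (hX₀x ▸ hX₀.2)
  have hGO : ∀ X ∈ O, X.submodule ≤ G → X.submodule ≤ T ⊔ Submodule.span K {x} := by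
    intro X hX hXG
    by_contra hXT
    have h1 := hsat X₀ hX₀.1 (by rw [hX₀x, hF]; exact hGs.mono hTxG) hX₀T'
    have h2 := ncard_points_lt hTxG hX hXT hXG
    rw [hO.2 G hG] at h2
    rw [hX₀x] at h1
    omega
  have hTr : Module.finrank K T + 1 ≤ P.rank := by
    rw [← hG.2]
    exact Submodule.finrank_lt_finrank_of_lt (lt_of_le_of_ne hTG fun h => hxT (h ▸ hxG))
  obtain ⟨n, hn⟩ := Nat.exists_eq_add_of_le hTr
  refine ⟨Module.finrank K T, n, hTd, hn, ?_⟩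
  obtain ⟨a, haT, hax, hax', hai⟩ := exists_dual_family (T := T.submoduleOf G) (x := ⟨x, hxG⟩)
    (n := n) hxT (by rw [hG.2, (Submodule.submoduleOfEquivOfLe hTG).finrank_eq, hn])
  choose v hv using fun k => hGs.exists_form_eq (a k)
  -- The coordinate 1 at `none` normalises the functional at x; the others run over K^n.
  let β : (Fin n → K) → Option (Fin n) → K := fun i k => k.elim 1 i
  let A : (Fin n → K) → Module.Dual K G := fun i => ∑ k, β i k • a k
  let w : (Fin n → K) → V := fun i => ∑ k, F.σ (β i k) • v k
  have hw : ∀ i (g : G), F.form (w i) g = A i g := fun i g => by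
    simp [w, A, hv, F.involutive _]
  have hAx : ∀ i, A i ⟨x, hxG⟩ = 1 := fun i => by
    simp [A, Fintype.sum_option, hax, hax', β]
  have hAT : ∀ i, ∀ t (ht : t ∈ T), A i ⟨t, hTG ht⟩ = 0 := fun i t ht => by
    simp [A, haT _ ⟨t, hTG ht⟩ ht]
  have hAinj : ∀ i j, A i = A j → i = j := by
    intro i j hij
    have h : ∑ k, i k • a (some k) = ∑ k, j k • a (some k) := by
      simpa [A, Fintype.sum_option, β] using hij
    exact hai.fintypeLinearCombination_injective h
  choose g hgG Y hYO hY using fun i => hO.exists_point hF hG hTm hxG hGO (v := w i)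
    (fun t ht => (hw i ⟨t, hTG ht⟩).trans (hAT i t ht)) ((hw i ⟨x, hxG⟩).trans (hAx i))
  have hyG : ∀ i (z : G), F.form (g i + w i) z = A i z := fun i z => by
    simp [hGs.2 _ (hgG i) _ z.2, hw]
  have hyT : ∀ i, ∀ t ∈ T, F.form t (g i + w i) = 0 := fun i t ht =>
    F.form_comm ((hyG i ⟨t, hTG ht⟩).trans (hAT i t ht))
  have hzero : ∀ i j, F.form (g i + w i) (g j + w j) = 0 ↔ i = j := by
    intro i j
    constructor
    · intro h0
      by_contra hij
      refine hO.form_ne_zero hF hT hsat (hYO i) (hYO j) (hY i) (hY j) (hyT i) (hyT j) ?_ ?_ h0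
      · intro hi
        have h1 := hyG i ⟨x, hxG⟩
        rw [hAx, hGs.2 _ (hTG hi) _ hxG] at h1
        exact zero_ne_one h1
      · intro hj
        obtain ⟨t, ht, s, hs, hts⟩ := Submodule.mem_sup.1 hj
        obtain ⟨e, rfl⟩ := Submodule.mem_span_singleton.1 hs
        have h1 : ∀ z : G, A j z = F.σ e * A i z := fun z => by
          rw [← hyG j, ← hyG i, ← hts, map_add, LinearMap.add_apply, hGs.2 _ (hTG ht) _ z.2]
          simp [mul_add]
        have he : F.σ e = 1 := by
          have := h1 ⟨x, hxG⟩
          rw [hAx, hAx, mul_one] at this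
          exact this.symm
        exact hij (hAinj i j (LinearMap.ext fun z => by rw [h1, he, one_mul]))
    · rintro rfl
      exact F.form_self (((hF _).1 (hO.1 (hYO i))).1 _
        (hY i ▸ Submodule.mem_span_singleton_self _))
  -- Expand the form at (y_i, g_j + w_j): A_i(g_j) and the value at w_j are each sums over n + 1
  -- indices.
  refine ⟨Matrix.of fun i => Sum.elim (β i) fun k => F.form (g i + w i) (v k),
    Matrix.of fun k j => k.elim (fun k => a k ⟨g j, hgG j⟩) fun k => F.σ (β j k), fun i j => ?_⟩
  rw [← hzero, Matrix.mul_apply, Fintype.sum_sum_type, map_add _ (g j), hyG i ⟨g j, hgG j⟩]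
  simp only [Matrix.of_apply]
  generalize g i + w i = y
  simp [A, w, mul_comm]

end ClassicalPolarSpace

/-! ### Conclusion -/

theorem corollary3p2 {K V : Type*} [Field K] [Finite K] [AddCommGroup V] [Module K V]
    [FiniteDimensional K V] (p : ℕ) [CharP K p] (P : ClassicalPolarSpace K V) (m : ℕ) (hm : 2 ≤ m)
    (hr : ((m : ℝ) + Real.logb (p : ℝ) ((2 * (m : ℝ)) ^ 2)) * ((p : ℝ) - 1) + 1 ≤ (P.rank : ℝ)) :
    ¬ ∃ O : Set (ℙ K V), P.IsMOvoid m O := by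
  rintro ⟨O, hO⟩
  have := Fintype.ofFinite K
  obtain ⟨h, hp, hq⟩ := FiniteField.card K p
  have : Fact p.Prime := ⟨hp⟩
  obtain ⟨d, n, hd, hrank, C, Z, hCZ⟩ := hO.exists_matrix (by omega)
  have hcard := card_le_of_mul_apply_eq_zero_iff hq C Z hCZ
  have hnum := two_mul_pow_mul_le_pow_rank hp.two_le hm hr
  simp only [Fintype.card_fun, Fintype.card_fin, hq, Fintype.card_sum, Fintype.card_option]
    at hcard
  set b := (n + 1 + (n + 1)) ^ (p - 1) with hb
  have hb2 : 2 ≤ b := by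
    calc 2 ≤ n + 1 + (n + 1) := by omega
      _ ≤ b := Nat.le_self_pow (Nat.sub_ne_zero_of_lt hp.one_lt) _
  -- The estimate is stated for r; d ≤ m - 1 and n + 1 ≤ r transfer it to n after cancelling p^d.
  have hab : 2 * b ≤ p ^ n := by
    refine le_of_mul_le_mul_left (a := p ^ d) ?_ (pow_pos hp.pos d)
    calc p ^ d * (2 * b) = 2 * p ^ d * b := by ring
      _ ≤ 2 * p ^ (m - 1) * (2 * P.rank) ^ (p - 1) := by
        rw [hb]
        gcongr
        · exact hp.one_le
        · omega
        · omega
      _ ≤ p ^ (P.rank - 1) := hnum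
      _ = p ^ d * p ^ n := by rw [hrank, ← pow_add]; congr 1; omega
  -- Impossible: the left side is at least 2b^h, and b^h ≥ 2.
  have h1 : (2 * b) ^ (h : ℕ) ≤ b ^ (h : ℕ) + 1 := by
    calc (2 * b) ^ (h : ℕ) ≤ (p ^ n) ^ (h : ℕ) := Nat.pow_le_pow_left hab _
      _ = (p ^ (h : ℕ)) ^ n := by rw [← pow_mul, ← pow_mul, mul_comm]
      _ ≤ _ := hcard
  have h2 : b ≤ b ^ (h : ℕ) := Nat.le_self_pow h.ne_zero b
  have h3 : 2 ≤ 2 ^ (h : ℕ) := Nat.le_self_pow h.ne_zero 2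
  rw [mul_pow] at h1
  nlinarith
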